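/- Let $m$ be Lebesgue measure on $[0,1]$. A piecewise expanding map is a map $T:[0,1]\to[0,1]$ together with a finite partition $\mathcal A_T$ of $[0,1]$ into non-degenerate intervals with disjoint interiors such that, on the interior of each interval of $\mathcal A_T$, $T$ coincides with a function which is $C^2$ on a neighbourhood of the closed interval, and such that $\inf|T'|>1$ (the infimum over the interiors of the intervals). Its transfer operator $P_T:L^1(m)\to L^1(m)$ is given by $\int P_Tf\cdot g\,dm=\int f\cdot g\circ T\,dm$ for $f\in L^1(m)$, $g\in L^\infty(m)$. For $f\in L^1(m)$ let $V(f)$ be the infimum of the total variations on $[0,1]$ of the functions equal to $f$ almost everywhere, let $\|f\|_{BV}=V(f)+\|f\|_{L^1(m)}$, and let $BV=\{f\in L^1(m): V(f)<\infty\}$. Let $\mathcal C$ be a class of piecewise expanding maps such that: 1. $(D_r)$ for some integer $r\ge1$: there are $0<\rho<1$ and $M_0,C_0>0$ such that $\|P_Tf\|_{BV}\le M_0\|f\|_{BV}$ for all $T\in\mathcal C$ and $f\in BV$, and $\|P_{S_r}\cdots P_{S_1}f\|_{BV}\le\rho\|f\|_{BV}+C_0\|f\|_{L^1(m)}$ for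 all $S_1,\dots,S_r\in\mathcal C$ and $f\in BV$; 2. (Dec): there are $0\le\theta<1$ and $K>0$ such that $\|P_{S_l}\cdots P_{S_1}f\|_{BV}\le K\theta^l\|f\|_{BV}$ for all $l\ge1$, all $S_1,\dots,S_l\in\mathcal C$ and all $f\in BV$ with $\int f\,dm=0$; 3. there are $\lambda>1$ and $M\ge1$ such that $|T'|\ge\lambda$ and $|T''|\le M$ on the interiors of the intervals of $\mathcal A_T$, for all $T\in\mathcal C$; 4. there is $N\ge1$ such that $\mathcal A_T$ has at most $N$ elements for all $T\in\mathcal C$. Let $(T_n)_{n\ge1}$ be a sequence in $\mathcal C$, put $T_1^0=\mathrm{id}$ and $T_1^n=T_n\circ\cdots\circ T_1$, and suppose that (Min) holds: there is $\delta>0$ such that $P_{T_1^n}\mathbf 1\ge\delta$ $m$-almost everywhere for all $n\ge1$. Then there exists $C>0$ such that for every $L>0$, every function $f:[0,1]\to\mathbb R$ with $|f(x)-f(y)|\le L|x-y|$ for all $x,y$, all $n\ge1$ and all $t>0$, $$m\left(\frac1n\sum_{k=0}^{n-1}\Big[f\circ T_1^k-\int f\circ T_1^k\,dm\Big]>t\right)\le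 e^{-\frac{C n t^2}{L^2}}.$$ In particular, for non-constant $f$ one may take for $L$ the least Lipschitz constant $\mathrm{Lip}(f)$; for constant $f$ the left-hand side is $0$. -/

import Mathlib

open MeasureTheory Set
open scoped NNReal ENNReal

noncomputable section

namespace SeqDyn

/-- The map `T : [0,1] → [0,1]`, viewed as a function `ℝ → ℝ` (it is constant to the left of `0` and
to the right of `1`), so that its derivatives at interior points of `[0,1]` make sense. -/
def lift (T : unitInterval → unitInterval) (x : ℝ) : ℝ :=
  (T (projIcc (0 : ℝ) 1 zero_le_one x) : ℝ)

/-- A piecewise expanding map of `[0,1]`, together with its partition: there are cut points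
`0 = c₀ < c₁ < ⋯ < c_N = 1` such that on each `(c_i, c_{i+1})` the map coincides with a function of
class `C²` on a neighbourhood of `[c_i, c_{i+1}]`, and `inf |T'| > 1`. The values of the map at the
cut points are not restricted. -/
structure PiecewiseExpandingMap where
  toFun : unitInterval → unitInterval
  pieces : ℕ
  cut : Fin (pieces + 1) → ℝ
  cut_strictMono : StrictMono cut
  cut_zero : cut 0 = 0
  cut_last : cut (Fin.last pieces) = 1
  exists_extension : ∀ i : Fin pieces, ∃ (U : Set ℝ) (g : ℝ → ℝ), IsOpen U ∧
    Icc (cut i.castSucc) (cut i.succ) ⊆ U ∧ ContDiffOn ℝ 2 g U ∧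
    EqOn (lift toFun) g (Ioo (cut i.castSucc) (cut i.succ))
  expanding : ∃ lam : ℝ, 1 < lam ∧ ∀ i : Fin pieces,
    ∀ x ∈ Ioo (cut i.castSucc) (cut i.succ), lam ≤ |deriv (lift toFun) x|

/-- The transfer operator `P_T` with respect to Lebesgue measure `m` on `[0,1]`: `P_T f` is the
density with respect to `m` of the image under `T` of the signed measure `f dm`
(computed separately for the positive and the negative part of `f`). -/
def transferOp (T : unitInterval → unitInterval) (f : unitInterval → ℝ) (x : unitInterval) : ℝ :=
  ((((volume.withDensity fun y => ENNReal.ofReal (f y)).map T).rnDeriv volume x).toReal) -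
  ((((volume.withDensity fun y => ENNReal.ofReal (-f y)).map T).rnDeriv volume x).toReal)

/-- `P_{S_l} ⋯ P_{S_1} f`, where the tuple `(S_1, …, S_l)` is `(S 0, …, S (l - 1))`. -/
def transferIter (S : ℕ → PiecewiseExpandingMap) : ℕ → (unitInterval → ℝ) → (unitInterval → ℝ)
  | 0, f => f
  | l + 1, f => transferOp (S l).toFun (transferIter S l f)

/-- `T_1^n = T_n ∘ ⋯ ∘ T_1` (with `T_1^0 = id`), where the sequence `(T_n)_{n ≥ 1}` is indexed from
zero: `T k` is the map `T_{k+1}`. -/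
def orbitMap (T : ℕ → PiecewiseExpandingMap) : ℕ → unitInterval → unitInterval
  | 0 => id
  | n + 1 => (T n).toFun ∘ orbitMap T n

/-- The variation of a class of functions modulo a.e. equality: the infimum of the variations
on `[0,1]` of all the versions of `f`. -/
def essVar (f : unitInterval → ℝ) : ℝ≥0∞ :=
  ⨅ (g : unitInterval → ℝ) (_ : g =ᵐ[volume] f), eVariationOn g univ

/-- The norm `‖f‖_BV = V(f) + ‖f‖_{L¹}`, with values in `[0, ∞]`. -/
def bvNorm (f : unitInterval → ℝ) : ℝ≥0∞ :=
  essVar f + eLpNorm f 1 volume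

/-- `f` belongs to the space BV. -/
def MemBV (f : unitInterval → ℝ) : Prop :=
  Integrable f volume ∧ essVar f < ∞

/-- The condition `(D_r)`: the transfer operators of the maps of the class are uniformly bounded on
BV, and all compositions of `r` of them satisfy a common Lasota-Yorke inequality. -/
def ConditionD (𝒞 : Set PiecewiseExpandingMap) (r : ℕ) : Prop :=
  ∃ ρ M₀ C : ℝ≥0, 0 < ρ ∧ ρ < 1 ∧ 0 < M₀ ∧ 0 < C ∧
    (∀ T ∈ 𝒞, ∀ f, MemBV f → bvNorm (transferOp T.toFun f) ≤ M₀ * bvNorm f) ∧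
    (∀ S : ℕ → PiecewiseExpandingMap, (∀ k < r, S k ∈ 𝒞) → ∀ f, MemBV f →
      bvNorm (transferIter S r f) ≤ ρ * bvNorm f + C * eLpNorm f 1 volume)

/-- The decorrelation property (Dec) on the space of BV functions with zero average. -/
def ConditionDec (𝒞 : Set PiecewiseExpandingMap) : Prop :=
  ∃ θ K : ℝ≥0, θ < 1 ∧ 0 < K ∧
    ∀ l : ℕ, 1 ≤ l → ∀ S : ℕ → PiecewiseExpandingMap, (∀ k < l, S k ∈ 𝒞) →
      ∀ f, MemBV f → ∫ x, f x = 0 → bvNorm (transferIter S l f) ≤ K * θ ^ l * bvNorm f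

/-- The assumptions on the class of maps. -/
structure AdmissibleClass (𝒞 : Set PiecewiseExpandingMap) : Prop where
  condD : ∃ r : ℕ, 1 ≤ r ∧ ConditionD 𝒞 r
  dec : ConditionDec 𝒞
  bounds : ∃ lam M : ℝ, 1 < lam ∧ 1 ≤ M ∧ ∀ T ∈ 𝒞, ∀ i : Fin T.pieces,
    ∀ x ∈ Ioo (T.cut i.castSucc) (T.cut i.succ),
      lam ≤ |deriv (lift T.toFun) x| ∧ |iteratedDeriv 2 (lift T.toFun) x| ≤ M
  pieces_le : ∃ N : ℕ, 1 ≤ N ∧ ∀ T ∈ 𝒞, T.pieces ≤ N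

/-- The minoration condition (Min): `P_{T_1^n} 1 ≥ δ` almost everywhere, for some `δ > 0` and
all `n`. -/
def ConditionMin (T : ℕ → PiecewiseExpandingMap) : Prop :=
  ∃ δ : ℝ, 0 < δ ∧ ∀ n : ℕ, 1 ≤ n →
    ∀ᵐ x : unitInterval, δ ≤ transferOp (orbitMap T n) (fun _ => 1) x

end SeqDyn

end

/-! The proof is a reversed martingale decomposition followed by the Azuma-Hoeffding inequality.
Write `φ_j` for `f` minus its mean at time `j`, `h_k = P_{T_1^k} 1` for the density at time `k`, and
set `g_k = h_k⁻¹ ∑_{j<k} P_{T_k} ⋯ P_{T_{j+1}} (φ_j h_j)`. By duality, `g_k ∘ T_1^k` is the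
conditional expectation of `∑_{j<k} φ_j ∘ T_1^j` given `T_1^k`.

The main point is that `|g_k| ≤ A L` with `A` independent of `k`, `f` and `L`
(`exists_condExp_pastSum`). Condition `(D_r)` bounds `h_j` in BV uniformly in `j`; `φ_j h_j` has
mean zero, so (Dec) makes the terms decay geometrically in BV, hence in sup norm; (Min) allows
division by `h_k`.

Now `X_k = φ_k ∘ T_1^k + g_k ∘ T_1^k - g_{k+1} ∘ T_1^{k+1}` is a function of `T_1^k`, is bounded by
`(1 + 2A) L`, and is orthogonal to every bounded measurable function of `T_1^{k+1}`
(`integral_revDiff_mul_exp`). These differences, completed by `X_n = g_n ∘ T_1^n`, sum exactly to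
the centred Birkhoff sum, and `measure_lt_sum_le` applies. -/

namespace SeqDyn

/-! ### Piecewise expanding maps are non-singular. -/

namespace PiecewiseExpandingMap

variable (T : PiecewiseExpandingMap)

theorem lift_coe (T : unitInterval → unitInterval) (x : unitInterval) : lift T x = T x := by
  simp [lift]

/-- The points of `[0,1]` in the interior of the `i`-th interval of the partition. -/
def branch (i : Fin T.pieces) : Set unitInterval :=
  {x | (x : ℝ) ∈ Ioo (T.cut i.castSucc) (T.cut i.succ)}

theorem isOpen_branch (i : Fin T.pieces) : IsOpen (T.branch i) :=
  isOpen_Ioo.preimage continuous_subtype_val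

theorem exists_mem_branch {x : unitInterval} (hx : ∀ j, (x : ℝ) ≠ T.cut j) :
    ∃ i, x ∈ T.branch i := by
  have key : ∀ k : Fin (T.pieces + 1), (x : ℝ) < T.cut k → ∃ i, x ∈ T.branch i := by
    intro k
    induction k using Fin.induction with
    | zero => intro h; rw [T.cut_zero] at h; exact absurd x.2.1 (not_le.2 h)
    | succ k ih =>
      intro h
      rcases lt_trichotomy (x : ℝ) (T.cut k.castSucc) with h' | h' | h'
      · exact ih h'
      · exact absurd h' (hx _)
      · exact ⟨k, h', h⟩
  refine key (Fin.last _) (lt_of_le_of_ne ?_ (hx _))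
  rw [T.cut_last]
  exact x.2.2

theorem finite_cutPoints : {x : unitInterval | ∃ j, (x : ℝ) = T.cut j}.Finite := by
  refine ((finite_range T.cut).preimage (f := ((↑) : unitInterval → ℝ))
    Subtype.val_injective.injOn).subset ?_
  rintro x ⟨j, hj⟩
  exact ⟨j, hj.symm⟩

theorem differentiableAt_lift (i : Fin T.pieces) {x : ℝ}
    (hx : x ∈ Ioo (T.cut i.castSucc) (T.cut i.succ)) : DifferentiableAt ℝ (lift T.toFun) x := by
  obtain ⟨U, g, hU, hIU, hg, hE⟩ := T.exists_extension i
  have hgx : DifferentiableAt ℝ g x :=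
    (hg.contDiffAt (hU.mem_nhds (hIU (Ioo_subset_Icc_self hx)))).differentiableAt (by norm_num)
  exact hgx.congr_of_eventuallyEq (hE.eventuallyEq_of_mem (isOpen_Ioo.mem_nhds hx))

theorem deriv_lift_ne_zero (i : Fin T.pieces) {x : ℝ}
    (hx : x ∈ Ioo (T.cut i.castSucc) (T.cut i.succ)) : deriv (lift T.toFun) x ≠ 0 := by
  obtain ⟨lam, h1, h⟩ := T.expanding
  intro h0
  have := h i x hx
  rw [h0, abs_zero] at this
  linarith

theorem injOn_lift (i : Fin T.pieces) :
    InjOn (lift T.toFun) (Ioo (T.cut i.castSucc) (T.cut i.succ)) := by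
  have key : ∀ x ∈ Ioo (T.cut i.castSucc) (T.cut i.succ),
      ∀ y ∈ Ioo (T.cut i.castSucc) (T.cut i.succ), x < y → lift T.toFun x ≠ lift T.toFun y := by
    intro x hx y hy hxy he
    have hsub : Icc x y ⊆ Ioo (T.cut i.castSucc) (T.cut i.succ) :=
      fun z hz => ⟨hx.1.trans_le hz.1, hz.2.trans_lt hy.2⟩
    obtain ⟨z, hz, hz0⟩ := exists_deriv_eq_zero hxy
      (fun z hz => (T.differentiableAt_lift i (hsub hz)).continuousAt.continuousWithinAt) he
    exact T.deriv_lift_ne_zero i (hsub (Ioo_subset_Icc_self hz)) hz0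
  intro x hx y hy he
  rcases lt_trichotomy x y with h | h | h
  · exact absurd he (key x hx y hy h)
  · exact h
  · exact absurd he.symm (key y hy x hx h)

theorem measurable_toFun : Measurable T.toFun := by
  refine measurable_of_measurable_on_compl_finite _ T.finite_cutPoints ?_
  refine Continuous.measurable ?_
  rw [← continuousOn_iff_continuous_domRestrict]
  intro x hx
  have hx' : ∀ j, (x : ℝ) ≠ T.cut j := fun j hj => hx ⟨j, hj⟩
  obtain ⟨i, hi⟩ := T.exists_mem_branch hx'
  refine ContinuousAt.continuousWithinAt ?_
  rw [Topology.IsInducing.subtypeVal.continuousAt_iff]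
  have h1 : ContinuousAt (fun y : unitInterval => lift T.toFun y) x :=
    ContinuousAt.comp (g := lift T.toFun) (T.differentiableAt_lift i hi).continuousAt
      continuous_subtype_val.continuousAt
  simp only [lift_coe] at h1
  exact h1

/-- On one injective branch, change of variables gives `0 = |T(s)| = ∫_s |T'|` for the preimage `s`;
as `T'` does not vanish there, `s` is null. -/
theorem volume_preimage_inter_branch {A : Set unitInterval} (hA : MeasurableSet A)
    (h0 : volume A = 0) (i : Fin T.pieces) : volume (T.toFun ⁻¹' A ∩ T.branch i) = 0 := by
  have hm : MeasurableSet (T.toFun ⁻¹' A ∩ T.branch i) :=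
    (T.measurable_toFun hA).inter (T.isOpen_branch i).measurableSet
  rw [unitInterval.volume_apply] at h0 ⊢
  set s : Set ℝ := Subtype.val '' (T.toFun ⁻¹' A ∩ T.branch i) with hs
  have hsm : MeasurableSet s := unitInterval.measurableEmbedding_coe.measurableSet_image.2 hm
  have hsub : s ⊆ Ioo (T.cut i.castSucc) (T.cut i.succ) := by
    rintro _ ⟨x, hx, rfl⟩
    exact hx.2
  have himg : volume (lift T.toFun '' s) = 0 := by
    refine measure_mono_null ?_ h0
    rintro _ ⟨_, ⟨x, hx, rfl⟩, rfl⟩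
    exact ⟨T.toFun x, hx.1, (lift_coe _ _).symm⟩
  have hcv := lintegral_image_eq_lintegral_abs_deriv_mul hsm
    (fun x hx => (T.differentiableAt_lift i (hsub hx)).hasDerivAt.hasDerivWithinAt)
    ((T.injOn_lift i).mono hsub) (fun _ => 1)
  rw [lintegral_one, Measure.restrict_apply_univ, himg] at hcv
  by_contra hne
  have hpos : 0 < ∫⁻ x in s, ENNReal.ofReal |deriv (lift T.toFun) x| * 1 := by
    rw [setLIntegral_pos_iff (by fun_prop)]
    refine lt_of_lt_of_le (pos_iff_ne_zero.2 hne) (measure_mono fun x hx => ⟨?_, hx⟩)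
    simpa using T.deriv_lift_ne_zero i (hsub hx)
  exact hpos.ne hcv

theorem quasiMeasurePreserving :
    Measure.QuasiMeasurePreserving T.toFun volume volume := by
  refine ⟨T.measurable_toFun, Measure.AbsolutelyContinuous.mk fun A hA h0 => ?_⟩
  rw [Measure.map_apply T.measurable_toFun hA]
  refine measure_mono_null (t := {x | ∃ j, (x : ℝ) = T.cut j} ∪
    ⋃ i, T.toFun ⁻¹' A ∩ T.branch i) ?_ ?_
  · intro x hx
    by_cases h : ∃ j, (x : ℝ) = T.cut j
    · exact Or.inl h
    · push Not at h
      obtain ⟨i, hi⟩ := T.exists_mem_branch h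
      exact Or.inr (mem_iUnion.2 ⟨i, hx, hi⟩)
  · rw [measure_union_null_iff, measure_iUnion_null_iff]
    exact ⟨T.finite_cutPoints.measure_zero _, T.volume_preimage_inter_branch hA h0⟩

end PiecewiseExpandingMap

theorem quasiMeasurePreserving_orbitMap (T : ℕ → PiecewiseExpandingMap) (n : ℕ) :
    Measure.QuasiMeasurePreserving (orbitMap T n) volume volume := by
  induction n with
  | zero => exact Measure.QuasiMeasurePreserving.id _
  | succ n ih => exact (T n).quasiMeasurePreserving.comp ih

/-! ### Duality between transfer operators and composition. -/

section Duality

variable {T : unitInterval → unitInterval} {f G : unitInterval → ℝ}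

theorem measurable_transferOp (T : unitInterval → unitInterval) (f : unitInterval → ℝ) :
    Measurable (transferOp T f) :=
  (Measure.measurable_rnDeriv _ _).ennreal_toReal.sub
    (Measure.measurable_rnDeriv _ _).ennreal_toReal

theorem integrable_transferOp (hf : Integrable f) : Integrable (transferOp T f) := by
  have h1 : IsFiniteMeasure (volume.withDensity fun y => ENNReal.ofReal (f y)) :=
    isFiniteMeasure_withDensity_ofReal hf.2
  have h2 : IsFiniteMeasure (volume.withDensity fun y => ENNReal.ofReal (-f y)) :=
    isFiniteMeasure_withDensity_ofReal hf.neg.2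
  exact Measure.integrable_toReal_rnDeriv.sub Measure.integrable_toReal_rnDeriv

theorem integral_rnDeriv_map_withDensity_mul (hT : Measure.QuasiMeasurePreserving T volume volume)
    (hf : Integrable f) (hG : Measurable G) :
    ∫ x, ((((volume.withDensity fun y => ENNReal.ofReal (f y)).map T).rnDeriv volume x).toReal) * G x
      = ∫ x, max (f x) 0 * G (T x) := by
  have h1 : IsFiniteMeasure (volume.withDensity fun y => ENNReal.ofReal (f y)) :=
    isFiniteMeasure_withDensity_ofReal hf.2
  have hac : (volume.withDensity fun y => ENNReal.ofReal (f y)).map T ≪ volume :=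
    ((withDensity_absolutelyContinuous _ _).map hT.measurable).trans hT.absolutelyContinuous
  have := integral_rnDeriv_smul (f := G) hac
  simp only [smul_eq_mul] at this
  rw [this, integral_map hT.measurable.aemeasurable hG.aestronglyMeasurable,
    integral_withDensity_eq_integral_toReal_smul₀ hf.aemeasurable.ennreal_ofReal
      (ae_of_all _ fun _ => ENNReal.ofReal_lt_top)]
  simp only [ENNReal.toReal_ofReal', smul_eq_mul]

theorem integrable_mul_of_abs_le {u v : unitInterval → ℝ} (hu : Integrable u) (hv : Measurable v)
    {c : ℝ} (hc : ∀ x, |v x| ≤ c) : Integrable fun x => u x * v x :=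
  hu.mul_bdd hv.aestronglyMeasurable (ae_of_all _ hc)

/-- Non-singularity makes the image measures absolutely continuous, so their Radon-Nikodym
derivatives lose no mass. -/
theorem integral_transferOp_mul (hT : Measure.QuasiMeasurePreserving T volume volume)
    (hf : Integrable f) (hG : Measurable G) {c : ℝ} (hc : ∀ x, |G x| ≤ c) :
    ∫ x, transferOp T f x * G x = ∫ x, f x * G (T x) := by
  have h1 : IsFiniteMeasure (volume.withDensity fun y => ENNReal.ofReal (f y)) :=
    isFiniteMeasure_withDensity_ofReal hf.2
  have h2 : IsFiniteMeasure (volume.withDensity fun y => ENNReal.ofReal (-f y)) :=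
    isFiniteMeasure_withDensity_ofReal hf.neg.2
  simp only [transferOp, sub_mul]
  rw [integral_sub (integrable_mul_of_abs_le Measure.integrable_toReal_rnDeriv hG hc)
    (integrable_mul_of_abs_le Measure.integrable_toReal_rnDeriv hG hc),
    integral_rnDeriv_map_withDensity_mul hT hf hG,
    integral_rnDeriv_map_withDensity_mul (f := fun y => -f y) hT hf.neg hG,
    ← integral_sub (integrable_mul_of_abs_le hf.pos_part (v := fun x => G (T x)) (hG.comp hT.measurable)
      fun x => hc _)
      (integrable_mul_of_abs_le hf.neg_part (v := fun x => G (T x)) (hG.comp hT.measurable)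
      fun x => hc _)]
  refine integral_congr_ae (ae_of_all _ fun x => ?_)
  simp only [← sub_mul]
  congr 1
  rcases le_total (f x) 0 with h | h
  · rw [max_eq_right h, max_eq_left (by linarith)]; ring
  · rw [max_eq_left h, max_eq_right (by linarith)]; ring

end Duality

variable {f G : unitInterval → ℝ}

theorem integrable_transferIter (S : ℕ → PiecewiseExpandingMap) (hf : Integrable f) (l : ℕ) :
    Integrable (transferIter S l f) := by
  induction l with
  | zero => exact hf
  | succ l ih => exact integrable_transferOp ih

theorem measurable_transferIter (S : ℕ → PiecewiseExpandingMap) (hf : Measurable f) (l : ℕ) :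
    Measurable (transferIter S l f) := by
  cases l with
  | zero => exact hf
  | succ l => exact measurable_transferOp _ _

theorem integral_transferIter_mul (S : ℕ → PiecewiseExpandingMap) (hf : Integrable f) (l : ℕ)
    (hG : Measurable G) {c : ℝ} (hc : ∀ x, |G x| ≤ c) :
    ∫ x, transferIter S l f x * G x = ∫ x, f x * G (orbitMap S l x) := by
  induction l generalizing G with
  | zero => rfl
  | succ l ih =>
    rw [transferIter, integral_transferOp_mul (S l).quasiMeasurePreserving
      (integrable_transferIter S hf l) hG hc]
    exact ih (hG.comp (S l).measurable_toFun) fun x => hc _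

theorem transferIter_add (S : ℕ → PiecewiseExpandingMap) (j l : ℕ) (f : unitInterval → ℝ) :
    transferIter S (j + l) f = transferIter (fun i => S (j + i)) l (transferIter S j f) := by
  induction l with
  | zero => rfl
  | succ l ih => rw [← add_assoc, transferIter, transferIter, ih]

theorem orbitMap_add (S : ℕ → PiecewiseExpandingMap) (j l : ℕ) (x : unitInterval) :
    orbitMap S (j + l) x = orbitMap (fun i => S (j + i)) l (orbitMap S j x) := by
  induction l with
  | zero => rfl
  | succ l ih => rw [← add_assoc, orbitMap, orbitMap, Function.comp_apply, Function.comp_apply, ih]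

/-- Both sides have the same integral over every measurable set. This links (Min), stated for the
composed map, with `(D_r)` and (Dec), stated for products of operators. -/
theorem transferIter_ae_eq_transferOp (S : ℕ → PiecewiseExpandingMap) (hf : Integrable f) (l : ℕ) :
    transferIter S l f =ᵐ[volume] transferOp (orbitMap S l) f := by
  refine Integrable.ae_eq_of_forall_setIntegral_eq _ _ (integrable_transferIter S hf l)
    (integrable_transferOp hf) fun s hs _ => ?_
  have hind : ∀ u : unitInterval → ℝ, ∫ x in s, u x = ∫ x, u x * s.indicator (fun _ => 1) x := by
    intro u
    rw [← integral_indicator hs]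
    congr 1 with x
    by_cases hx : x ∈ s <;> simp [hx]
  have hm : Measurable (s.indicator fun _ => (1 : ℝ)) := measurable_const.indicator hs
  have hb : ∀ x, |s.indicator (fun _ => (1 : ℝ)) x| ≤ 1 := by
    intro x
    by_cases hx : x ∈ s <;> simp [hx]
  rw [hind, hind, integral_transferIter_mul S hf l hm hb,
    integral_transferOp_mul (quasiMeasurePreserving_orbitMap S l) hf hm hb]

end SeqDyn

/-! ### BV estimates: sup bound and multiplication by Lipschitz functions. -/

namespace SeqDyn

variable {f g φ : unitInterval → ℝ}

theorem eVariationOn_le_of_edist_le {u : unitInterval → ℝ} {a b : ℝ≥0∞}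
    (h : ∀ x y, edist (u x) (u y) ≤ a * edist (g x) (g y) + b * edist x y) :
    eVariationOn u univ ≤ a * eVariationOn g univ + b := by
  have hid : eVariationOn ((↑) : unitInterval → ℝ) univ ≤ 1 := by
    have hm : MonotoneOn ((↑) : unitInterval → ℝ) univ := fun x _ y _ hxy => hxy
    have := hm.eVariationOn_eq (mem_univ (0 : unitInterval)) (mem_univ (1 : unitInterval))
    have hI : (univ : Set unitInterval) ∩ Icc 0 1 = univ := by
      exact inter_eq_left.2 fun x _ => ⟨unitInterval.nonneg', unitInterval.le_one'⟩
    rw [hI] at this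
    simp [this]
  refine iSup_le fun p => ?_
  calc ∑ i ∈ Finset.range p.1, edist (u (p.2.1 (i + 1))) (u (p.2.1 i))
      ≤ ∑ i ∈ Finset.range p.1, (a * edist (g (p.2.1 (i + 1))) (g (p.2.1 i)) +
          b * edist (p.2.1 (i + 1) : ℝ) (p.2.1 i)) := Finset.sum_le_sum fun i _ => h _ _
    _ = a * ∑ i ∈ Finset.range p.1, edist (g (p.2.1 (i + 1))) (g (p.2.1 i)) +
          b * ∑ i ∈ Finset.range p.1, edist (p.2.1 (i + 1) : ℝ) (p.2.1 i) := by
        rw [Finset.sum_add_distrib, Finset.mul_sum, Finset.mul_sum]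
    _ ≤ a * eVariationOn g univ + b * 1 := by
        gcongr
        · exact eVariationOn.sum_le p.2.2.1 p.2.2.2
        · exact (eVariationOn.sum_le p.2.2.1 p.2.2.2).trans hid
    _ = _ := by rw [mul_one]

/-- Average `|g x| ≤ |g x - g y| + |g y|` over `y`; the first term is at most the variation. -/
theorem enorm_le_eVariationOn_add (g : unitInterval → ℝ) (x : unitInterval) :
    ‖g x‖ₑ ≤ eVariationOn g univ + eLpNorm g 1 volume := by
  calc ‖g x‖ₑ = ∫⁻ _ : unitInterval, ‖g x‖ₑ := by simp
    _ ≤ ∫⁻ y, (eVariationOn g univ + ‖g y‖ₑ) := by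
        refine lintegral_mono fun y => ?_
        have h1 : ‖g x‖ₑ ≤ ‖g x - g y‖ₑ + ‖g y‖ₑ := by
          simpa using enorm_add_le (g x - g y) (g y)
        rw [← edist_eq_enorm_sub] at h1
        exact h1.trans (by gcongr; exact eVariationOn.edist_le g (mem_univ _) (mem_univ _))
    _ = _ := by
        rw [lintegral_add_left measurable_const, eLpNorm_one_eq_lintegral_enorm]
        simp

theorem essVar_le (h : g =ᵐ[volume] f) : essVar f ≤ eVariationOn g univ :=
  iInf₂_le (f := fun (g : unitInterval → ℝ) (_ : g =ᵐ[volume] f) => eVariationOn g univ) g h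

theorem le_mul_bvNorm {a : ℝ≥0∞} {c : ℝ≥0} (hc : 0 < c)
    (h : ∀ g, g =ᵐ[volume] f → a ≤ c * (eVariationOn g univ + eLpNorm g 1 volume)) :
    a ≤ c * bvNorm f := by
  have hc0 : (c : ℝ≥0∞) ≠ 0 := by exact_mod_cast hc.ne'
  simp only [bvNorm, essVar, ENNReal.iInf_add, ENNReal.mul_iInf_of_ne hc0 ENNReal.coe_ne_top]
  refine le_iInf fun g => ?_
  by_cases hg : g =ᵐ[volume] f
  · simpa only [hg, iInf_pos, eLpNorm_congr_ae hg] using h g hg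
  · simp [hg]

theorem enorm_ae_le_bvNorm (f : unitInterval → ℝ) : ∀ᵐ x, ‖f x‖ₑ ≤ bvNorm f := by
  have h : eLpNormEssSup f volume ≤ (1 : ℝ≥0) * bvNorm f := by
    refine le_mul_bvNorm one_pos fun g hg => essSup_le_of_ae_le _ ?_
    filter_upwards [hg] with x hx
    rw [← hx, ENNReal.coe_one, one_mul]
    exact enorm_le_eVariationOn_add g x
  rw [ENNReal.coe_one, one_mul] at h
  filter_upwards [enorm_ae_le_eLpNormEssSup f volume] with x hx using hx.trans h

theorem eLpNorm_one_le_bvNorm (f : unitInterval → ℝ) : eLpNorm f 1 volume ≤ bvNorm f :=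
  le_add_self

/-- Discrete Leibniz rule for a version `g` of `f`, whose supremum is controlled by variation plus
`L¹` norm. -/
theorem essVar_mul_le {L : ℝ≥0} (hL : 0 < L) (hφ : LipschitzWith L φ) (hb : ∀ x, ‖φ x‖ₑ ≤ L) :
    essVar (fun x => φ x * f x) ≤ (2 * L : ℝ≥0) * bvNorm f := by
  refine le_mul_bvNorm (by positivity) fun g hg => ?_
  set B := eVariationOn g univ + eLpNorm g 1 volume with hB
  have hfg : (fun x => φ x * g x) =ᵐ[volume] fun x => φ x * f x := by
    filter_upwards [hg] with x hx
    rw [hx]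
  refine (essVar_le hfg).trans ?_
  have h1 : eVariationOn (fun x => φ x * g x) univ ≤ L * eVariationOn g univ + B * L := by
    refine eVariationOn_le_of_edist_le fun x y => ?_
    calc edist (φ x * g x) (φ y * g y) = ‖φ x * (g x - g y) + g y * (φ x - φ y)‖ₑ := by
          rw [edist_eq_enorm_sub]; congr 1; ring
      _ ≤ ‖φ x‖ₑ * edist (g x) (g y) + ‖g y‖ₑ * edist (φ x) (φ y) := by
          rw [edist_eq_enorm_sub, edist_eq_enorm_sub, ← enorm_mul, ← enorm_mul]
          exact enorm_add_le _ _
      _ ≤ L * edist (g x) (g y) + B * (L * edist x y) := by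
          gcongr
          · exact hb x
          · exact enorm_le_eVariationOn_add g y
          · exact hφ x y
      _ = _ := by rw [mul_assoc]
  calc _ ≤ L * eVariationOn g univ + B * L := h1
    _ ≤ L * B + B * L := by gcongr; exact le_self_add
    _ = _ := by push_cast; ring

theorem bvNorm_mul_le {L : ℝ≥0} (hL : 0 < L) (hφ : LipschitzWith L φ) (hb : ∀ x, ‖φ x‖ₑ ≤ L) :
    bvNorm (fun x => φ x * f x) ≤ (3 * L : ℝ≥0) * bvNorm f := by
  have h1 : eLpNorm (fun x => φ x * f x) 1 volume ≤ L * eLpNorm f 1 volume := by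
    rw [eLpNorm_one_eq_lintegral_enorm, eLpNorm_one_eq_lintegral_enorm,
      ← lintegral_const_mul' _ _ ENNReal.coe_ne_top]
    refine lintegral_mono fun x => ?_
    rw [enorm_mul]
    gcongr
    exact hb x
  calc bvNorm (fun x => φ x * f x) ≤ (2 * L : ℝ≥0) * bvNorm f + L * bvNorm f :=
        add_le_add (essVar_mul_le hL hφ hb) (h1.trans (by gcongr; exact eLpNorm_one_le_bvNorm f))
    _ = _ := by push_cast; ring

theorem memBV_iff : MemBV f ↔ Integrable f ∧ bvNorm f < ∞ := by
  refine and_congr_right fun hf => ?_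
  rw [bvNorm, ENNReal.add_lt_top]
  exact ⟨fun h => ⟨h, (memLp_one_iff_integrable.2 hf).2⟩, fun h => h.1⟩

end SeqDyn

/-! ### Azuma-Hoeffding for reversed martingale differences. -/

namespace SeqDyn

section Azuma

variable {Ω : Type*} [MeasurableSpace Ω] {μ : Measure Ω} [IsProbabilityMeasure μ]
  {X : ℕ → Ω → ℝ} {c s : ℝ} {N : ℕ}

/-- By convexity, the exponential lies below its chord on `[-c, c]`. -/
theorem exp_mul_le_of_abs_le {x c : ℝ} (hc : 0 < c) (hx : |x| ≤ c) (s : ℝ) :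
    Real.exp (s * x) ≤ Real.cosh (s * c) + Real.sinh (s * c) / c * x := by
  have h1 : |x / c| ≤ 1 := by rwa [abs_div, abs_of_pos hc, div_le_one hc]
  have := Real.exp_mul_le_cosh_add_mul_sinh h1 (s * c)
  calc Real.exp (s * x) = Real.exp (x / c * (s * c)) := by congr 1; field_simp
    _ ≤ _ := this
    _ = _ := by ring

theorem exp_mul_sum_le {z : ℕ → ℝ} (hz : ∀ k, |z k| ≤ c) (s : ℝ) (A : Finset ℕ) :
    Real.exp (s * ∑ i ∈ A, z i) ≤ Real.exp (|s| * (A.card * c)) := by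
  refine Real.exp_le_exp.2 ?_
  calc s * ∑ i ∈ A, z i ≤ |s * ∑ i ∈ A, z i| := le_abs_self _
    _ = |s| * |∑ i ∈ A, z i| := abs_mul _ _
    _ ≤ |s| * (A.card * c) := by
        gcongr
        calc |∑ i ∈ A, z i| ≤ ∑ i ∈ A, |z i| := Finset.abs_sum_le_sum_abs _ _
          _ ≤ ∑ i ∈ A, c := Finset.sum_le_sum fun i _ => hz i
          _ = _ := by simp

theorem integrable_exp_mul_sum (hm : ∀ k, Measurable (X k)) (hb : ∀ k x, |X k x| ≤ c)
    (s : ℝ) (A : Finset ℕ) : Integrable (fun x => Real.exp (s * ∑ i ∈ A, X i x)) μ := by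
  refine Integrable.of_bound (by fun_prop) (Real.exp (|s| * (A.card * c))) (ae_of_all _ fun x => ?_)
  rw [Real.norm_eq_abs, Real.abs_exp]
  exact exp_mul_sum_le (fun i => hb i x) s A

/-- Exponential moments of a sum of bounded reversed martingale differences. -/
theorem integral_exp_mul_sum_le (hm : ∀ k, Measurable (X k)) (hc : 0 < c)
    (hb : ∀ k x, |X k x| ≤ c)
    (hX : ∀ k < N, ∫ x, X k x * Real.exp (s * ∑ i ∈ Finset.Ico (k + 1) N, X i x) ∂μ = 0) :
    ∫ x, Real.exp (s * ∑ i ∈ Finset.range N, X i x) ∂μ ≤ Real.exp (N * (s * c) ^ 2 / 2) := by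
  -- The tail sums grow backwards in time. Each new `X k` costs a factor `cosh (s c)`, because the
  -- linear term of the chord integrates to zero against the later differences.
  have key : ∀ m k, k + m = N → ∫ x, Real.exp (s * ∑ i ∈ Finset.Ico k N, X i x) ∂μ ≤
      Real.cosh (s * c) ^ m := by
    intro m
    induction m with
    | zero => rintro k rfl; simp
    | succ m ih =>
      intro k hk
      have hkN : k < N := by omega
      set E : Ω → ℝ := fun x => Real.exp (s * ∑ i ∈ Finset.Ico (k + 1) N, X i x) with hE
      have hEi : Integrable E μ := integrable_exp_mul_sum hm hb s _
      have hXE : Integrable (fun x => X k x * E x) μ :=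
        hEi.bdd_mul (hm k).aestronglyMeasurable (ae_of_all _ (hb k))
      calc ∫ x, Real.exp (s * ∑ i ∈ Finset.Ico k N, X i x) ∂μ
          ≤ ∫ x, (Real.cosh (s * c) * E x + Real.sinh (s * c) / c * (X k x * E x)) ∂μ := by
            refine integral_mono_ae (integrable_exp_mul_sum hm hb s _)
              ((hEi.const_mul _).add (hXE.const_mul _)) (ae_of_all _ fun x => ?_)
            beta_reduce
            rw [Finset.sum_eq_sum_Ico_succ_bot hkN, mul_add, Real.exp_add]
            have := mul_le_mul_of_nonneg_right (exp_mul_le_of_abs_le hc (hb k x) s)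
              (Real.exp_pos (s * ∑ i ∈ Finset.Ico (k + 1) N, X i x)).le
            exact this.trans_eq (by rw [hE]; ring)
        _ = Real.cosh (s * c) * ∫ x, E x ∂μ := by
            rw [integral_add (hEi.const_mul _) (hXE.const_mul _), integral_const_mul,
              integral_const_mul, hX k hkN, mul_zero, add_zero]
        _ ≤ Real.cosh (s * c) * Real.cosh (s * c) ^ m := by
            exact mul_le_mul_of_nonneg_left (ih (k + 1) (by omega)) (Real.cosh_pos _).le
        _ = _ := by ring
  have h0 := key N 0 (by omega)
  rw [Nat.Ico_zero_eq_range] at h0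
  calc _ ≤ Real.cosh (s * c) ^ N := h0
    _ ≤ Real.exp ((s * c) ^ 2 / 2) ^ N :=
      pow_le_pow_left₀ (Real.cosh_pos _).le (Real.cosh_le_exp_half_sq _) _
    _ = _ := by rw [← Real.exp_nat_mul]; congr 1; ring

/-- The Azuma-Hoeffding inequality for bounded reversed martingale differences. -/
theorem measure_lt_sum_le (hm : ∀ k, Measurable (X k)) (hc : 0 < c)
    (hb : ∀ k x, |X k x| ≤ c) (hN : 1 ≤ N)
    (hX : ∀ s : ℝ, ∀ k < N,
      ∫ x, X k x * Real.exp (s * ∑ i ∈ Finset.Ico (k + 1) N, X i x) ∂μ = 0)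
    {a : ℝ} (ha : 0 ≤ a) :
    μ {x | a < ∑ i ∈ Finset.range N, X i x} ≤
      ENNReal.ofReal (Real.exp (-(a ^ 2 / (2 * N * c ^ 2)))) := by
  have hN' : (0 : ℝ) < N := by exact_mod_cast hN
  -- The minimiser of the Chernoff exponent `N (s c)² / 2 - s a`.
  set s : ℝ := a / (N * c ^ 2) with hs
  have hs0 : 0 ≤ s := by positivity
  have h := ProbabilityTheory.measure_ge_le_exp_mul_mgf (μ := μ)
    (X := fun x => ∑ i ∈ Finset.range N, X i x) a hs0 (integrable_exp_mul_sum hm hb s _)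
  rw [ProbabilityTheory.mgf] at h
  refine (measure_mono (fun x (hx : a < _) => show _ from hx.le)).trans
    ((ENNReal.le_ofReal_iff_toReal_le (measure_ne_top μ _) (Real.exp_pos _).le).2
      (h.trans ?_))
  calc _ ≤ Real.exp (-s * a) * Real.exp (N * (s * c) ^ 2 / 2) := by
        gcongr
        exact integral_exp_mul_sum_le hm hc hb (hX s)
    _ = _ := by
        rw [← Real.exp_add]
        congr 1
        rw [hs]
        field_simp
        ring

end Azuma

end SeqDyn

/-! ### Uniform bounds on densities and on conditional expectations of the past. -/

namespace SeqDyn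

variable {T : ℕ → PiecewiseExpandingMap} {f : unitInterval → ℝ} {L : ℝ≥0}

/-- The density of the image of Lebesgue measure under `T_1^k`. -/
noncomputable def density (T : ℕ → PiecewiseExpandingMap) (k : ℕ) : unitInterval → ℝ :=
  transferIter T k fun _ => 1

theorem measurable_density (k : ℕ) : Measurable (density T k) :=
  measurable_transferIter T measurable_const k

theorem integrable_density (k : ℕ) : Integrable (density T k) :=
  integrable_transferIter T (integrable_const _) k

theorem integral_density_mul (k : ℕ) {G : unitInterval → ℝ} (hG : Measurable G) {c : ℝ}
    (hc : ∀ x, |G x| ≤ c) : ∫ x, density T k x * G x = ∫ x, G (orbitMap T k x) := by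
  simpa [density] using integral_transferIter_mul T (integrable_const (1 : ℝ)) k hG hc

theorem le_density (hmin : ConditionMin T) :
    ∃ δ : ℝ, 0 < δ ∧ ∀ k, ∀ᵐ x, δ ≤ density T k x := by
  obtain ⟨δ, hδ, h⟩ := hmin
  -- (Min) starts at `n = 1`; the density at time `0` is `1`.
  refine ⟨min δ 1, lt_min hδ one_pos, fun k => ?_⟩
  rcases Nat.eq_zero_or_pos k with rfl | hk
  · exact ae_of_all _ fun x => min_le_right _ _
  · filter_upwards [h k hk, transferIter_ae_eq_transferOp T (integrable_const (1 : ℝ)) k]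
      with x hx hx'
    rw [density, hx']
    exact (min_le_left _ _).trans hx

theorem eLpNorm_density (hmin : ConditionMin T) (k : ℕ) : eLpNorm (density T k) 1 volume = 1 := by
  obtain ⟨δ, hδ, h⟩ := le_density hmin
  have h0 : 0 ≤ᵐ[volume] density T k := by
    filter_upwards [h k] with x hx using hδ.le.trans hx
  have h1 : ∫ x, density T k x = 1 := by
    simpa using integral_density_mul (T := T) k (measurable_const (a := (1 : ℝ))) (c := 1) (by simp)
  rw [eLpNorm_one_eq_lintegral_enorm, ← ofReal_integral_norm_eq_lintegral_enorm
    (integrable_density k), integral_congr_ae (g := density T k), h1, ENNReal.ofReal_one]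
  filter_upwards [h0] with x hx using Real.norm_of_nonneg hx

/-- Densities have `L¹` norm `1`, so the Lasota-Yorke inequality reads `b_k ≤ ρ b_{k-r} + C` for
their BV norms. -/
theorem exists_bvNorm_density_le {𝒞 : Set PiecewiseExpandingMap} {r : ℕ} (hr : 1 ≤ r)
    (hD : ConditionD 𝒞 r) (hT : ∀ n, T n ∈ 𝒞) (hmin : ConditionMin T) :
    ∃ B : ℝ≥0, 0 < B ∧ ∀ k, bvNorm (density T k) ≤ B := by
  obtain ⟨ρ, M₀, C, -, hρ, -, hC, hM, hLY⟩ := hD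
  have hfin : ∀ k, bvNorm (density T k) < ∞ := by
    intro k
    induction k with
    | zero =>
      have h1 : essVar (density T 0) ≤ 0 := by
        refine (essVar_le (ae_eq_refl _)).trans
          (eVariationOn.constant_on ((subsingleton_singleton (a := (1 : ℝ))).anti
          (by rintro _ ⟨x, -, rfl⟩; rfl))).le
      rw [bvNorm, eLpNorm_density hmin]
      exact ENNReal.add_lt_top.2 ⟨h1.trans_lt ENNReal.zero_lt_top, ENNReal.one_lt_top⟩
    | succ k ih =>
      exact (hM (T k) (hT k) _ (memBV_iff.2 ⟨integrable_density k, ih⟩)).trans_lt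
        (ENNReal.mul_lt_top ENNReal.coe_lt_top ih)
  set b : ℕ → ℝ≥0 := fun k => (bvNorm (density T k)).toNNReal
  have hb : ∀ k, bvNorm (density T k) = b k := fun k => (ENNReal.coe_toNNReal (hfin k).ne).symm
  have hρ' : 0 < 1 - ρ := tsub_pos_of_lt hρ
  -- Dominates the first `r` norms and the fixed point of `b ↦ ρ b + C`, so the recursion preserves
  -- the bound `B`.
  set B : ℝ≥0 := ∑ i ∈ Finset.range r, b i + C / (1 - ρ) with hB
  have hstep : ρ * B + C ≤ B := by
    calc ρ * B + C = ρ * B + (1 - ρ) * (C / (1 - ρ)) := by rw [mul_div_cancel₀ _ hρ'.ne']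
      _ ≤ ρ * B + (1 - ρ) * B := by gcongr; exact le_add_self
      _ = B := by rw [← add_mul, add_tsub_cancel_of_le hρ.le, one_mul]
  refine ⟨B, lt_of_lt_of_le (div_pos hC hρ') le_add_self, fun k => ?_⟩
  induction k using Nat.strong_induction_on with
  | _ k ih =>
    rcases lt_or_ge k r with hk | hk
    · rw [hb k]
      exact_mod_cast (Finset.single_le_sum (f := b) (fun _ _ => zero_le) (Finset.mem_range.2 hk)).trans
        le_self_add
    · have h1 := hLY (fun i => T (k - r + i)) (fun i _ => hT _) (density T (k - r))
        (memBV_iff.2 ⟨integrable_density _, hfin _⟩)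
      rw [density, ← transferIter_add, Nat.sub_add_cancel hk, ← density, ← density,
        eLpNorm_density hmin, mul_one] at h1
      calc _ ≤ _ := h1
        _ ≤ ρ * (B : ℝ≥0∞) + C := by gcongr; exact ih _ (by omega)
        _ ≤ B := by exact_mod_cast hstep

/-- The observable `f` at time `j`, centred. -/
noncomputable def centred (T : ℕ → PiecewiseExpandingMap) (f : unitInterval → ℝ) (j : ℕ) (x : unitInterval) : ℝ :=
  f x - ∫ y, f (orbitMap T j y)

theorem lipschitzWith_centred (hf : LipschitzWith L f) (j : ℕ) :
    LipschitzWith L (centred T f j) := by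
  intro x y
  simpa only [centred, edist_sub_right] using hf x y

theorem abs_sub_le_of_lipschitzWith (hf : LipschitzWith L f) (x y : unitInterval) :
    |f x - f y| ≤ L := by
  have h := hf.dist_le_mul x y
  rw [Real.dist_eq] at h
  refine h.trans (mul_le_of_le_one_right L.2 ?_)
  rw [Subtype.dist_eq, Real.dist_eq, abs_le]
  constructor <;> linarith [x.2.1, x.2.2, y.2.1, y.2.2]

theorem integrable_comp_orbitMap {u : unitInterval → ℝ} (hu : Measurable u) {c : ℝ}
    (hc : ∀ x, |u x| ≤ c) (j : ℕ) : Integrable fun x => u (orbitMap T j x) :=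
  Integrable.of_bound (hu.comp (quasiMeasurePreserving_orbitMap T j).measurable).aestronglyMeasurable
    c (ae_of_all _ fun _ => hc _)

theorem integrable_lipschitz_comp_orbitMap (hf : LipschitzWith L f) (j : ℕ) :
    Integrable fun x => f (orbitMap T j x) := by
  refine integrable_comp_orbitMap hf.continuous.measurable (c := L + |f 0|) (fun x => ?_) j
  calc |f x| = |(f x - f 0) + f 0| := by ring_nf
    _ ≤ |f x - f 0| + |f 0| := abs_add_le _ _
    _ ≤ _ := by gcongr; exact abs_sub_le_of_lipschitzWith hf _ _

/-- The centred value is an average of differences of values of `f`, and `[0,1]` has diameter `1`;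
thus the size of `f` itself never enters. -/
theorem abs_centred_le (hf : LipschitzWith L f) (j : ℕ) (x : unitInterval) :
    |centred T f j x| ≤ L := by
  have h : centred T f j x = ∫ y, (f x - f (orbitMap T j y)) := by
    rw [integral_sub (integrable_const _) (integrable_lipschitz_comp_orbitMap hf j)]
    simp [centred]
  rw [h, ← Real.norm_eq_abs]
  simpa using norm_integral_le_of_norm_le_const (μ := volume) (C := (L : ℝ))
    (f := fun y => f x - f (orbitMap T j y)) (ae_of_all _ fun y => abs_sub_le_of_lipschitzWith hf x (orbitMap T j y))

theorem measurable_centred (hf : LipschitzWith L f) (j : ℕ) : Measurable (centred T f j) :=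
  (lipschitzWith_centred hf j).continuous.measurable

theorem integral_centred_comp_orbitMap (hf : LipschitzWith L f) (j : ℕ) :
    ∫ x, centred T f j (orbitMap T j x) = 0 := by
  simp only [centred]
  rw [integral_sub (integrable_lipschitz_comp_orbitMap hf j) (integrable_const _)]
  simp

/-- The image at time `k` of the centred observable at time `j`. -/
noncomputable def correlation (T : ℕ → PiecewiseExpandingMap) (f : unitInterval → ℝ) (j k : ℕ) :
    unitInterval → ℝ :=
  transferIter (fun i => T (j + i)) (k - j) fun x => centred T f j x * density T j x

theorem integrable_centred_mul_density (hf : LipschitzWith L f) (j : ℕ) :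
    Integrable fun x => centred T f j x * density T j x :=
  (integrable_density j).bdd_mul (measurable_centred hf j).aestronglyMeasurable
    (ae_of_all _ (abs_centred_le hf j))

theorem measurable_correlation (hf : LipschitzWith L f) (j k : ℕ) :
    Measurable (correlation T f j k) :=
  measurable_transferIter _ ((measurable_centred hf j).mul (measurable_density j)) _

theorem integrable_correlation (hf : LipschitzWith L f) (j k : ℕ) :
    Integrable (correlation T f j k) :=
  integrable_transferIter _ (integrable_centred_mul_density hf j) _

theorem integral_correlation_mul (hf : LipschitzWith L f) {j k : ℕ} (hjk : j ≤ k)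
    {G : unitInterval → ℝ} (hG : Measurable G) {c : ℝ} (hc : ∀ x, |G x| ≤ c) :
    ∫ x, correlation T f j k x * G x =
      ∫ x, centred T f j (orbitMap T j x) * G (orbitMap T k x) := by
  have hm := (quasiMeasurePreserving_orbitMap (fun i => T (j + i)) (k - j)).measurable
  have h2 := integral_density_mul (T := T) j
    (G := fun x => centred T f j x * G (orbitMap (fun i => T (j + i)) (k - j) x))
    ((measurable_centred hf j).mul (hG.comp hm)) (c := L * c) fun x => by
      rw [abs_mul]
      exact mul_le_mul (abs_centred_le hf j x) (hc _) (abs_nonneg _) L.2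
  rw [correlation, integral_transferIter_mul _ (integrable_centred_mul_density hf j) _ hG hc]
  simp only [← orbitMap_add, Nat.add_sub_cancel' hjk] at h2
  rw [← h2]
  congr 1 with x
  ring

/-- The product of centred observable and density has mean zero and BV norm at most `3 L B`; (Dec)
applies to it, and the BV norm dominates the essential supremum. -/
theorem abs_correlation_le {𝒞 : Set PiecewiseExpandingMap} {θ K B : ℝ≥0}
    (hDec : ∀ l : ℕ, 1 ≤ l → ∀ S : ℕ → PiecewiseExpandingMap, (∀ k < l, S k ∈ 𝒞) →
      ∀ f, MemBV f → ∫ x, f x = 0 → bvNorm (transferIter S l f) ≤ K * θ ^ l * bvNorm f)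
    (hT : ∀ n, T n ∈ 𝒞) (hB : ∀ k, bvNorm (density T k) ≤ B)
    (hL : 0 < L) (hf : LipschitzWith L f) {j k : ℕ} (hjk : j < k) :
    ∀ᵐ x, |correlation T f j k x| ≤ 3 * K * B * L * (θ : ℝ) ^ (k - j) := by
  have h1 : bvNorm (fun x => centred T f j x * density T j x) ≤ (3 * L * B : ℝ≥0) := by
    refine (bvNorm_mul_le hL (lipschitzWith_centred hf j) fun x => ?_).trans ?_
    · rw [← ofReal_norm, ← ENNReal.ofReal_coe_nnreal]
      exact ENNReal.ofReal_le_ofReal (abs_centred_le hf j x)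
    · rw [ENNReal.coe_mul (3 * L) B]
      gcongr
      exact hB j
  have h2 : ∫ x, centred T f j x * density T j x = 0 := by
    simp only [mul_comm (centred T f j _)]
    rw [integral_density_mul j (measurable_centred hf j) (abs_centred_le hf j),
      integral_centred_comp_orbitMap hf j]
  have h3 := hDec (k - j) (by omega) (fun i => T (j + i)) (fun i _ => hT _) _
    (memBV_iff.2 ⟨integrable_centred_mul_density hf j, h1.trans_lt ENNReal.coe_lt_top⟩) h2
  have h4 : bvNorm (correlation T f j k) ≤ (3 * K * B * L * θ ^ (k - j) : ℝ≥0) := by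
    calc _ ≤ _ := h3
      _ ≤ K * θ ^ (k - j) * (3 * L * B : ℝ≥0) := by gcongr
      _ = _ := by push_cast; ring
  filter_upwards [enorm_ae_le_bvNorm (correlation T f j k)] with x hx
  have h5 := hx.trans h4
  rw [enorm_le_coe] at h5
  exact_mod_cast h5

theorem sum_pow_sub_le {θ : ℝ} (h0 : 0 ≤ θ) (h1 : θ < 1) (k : ℕ) :
    ∑ j ∈ Finset.range k, θ ^ (k - j) ≤ (1 - θ)⁻¹ := by
  calc ∑ j ∈ Finset.range k, θ ^ (k - j) ≤ ∑ j ∈ Finset.range k, θ ^ (k - 1 - j) :=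
        Finset.sum_le_sum fun j _ => pow_le_pow_of_le_one h0 h1.le (by omega)
    _ = ∑ j ∈ Finset.range k, θ ^ j := Finset.sum_range_reflect (fun i => θ ^ i) k
    _ ≤ ∑' j, θ ^ j := (summable_geometric_of_lt_one h0 h1).sum_le_tsum _ fun j _ => by positivity
    _ = _ := tsum_geometric_of_lt_one h0 h1

/-- The conditional expectation given `T_1^k` of the sum of the observables at times `j < k`
is bounded, uniformly in `k`. -/
theorem exists_condExp_pastSum {𝒞 : Set PiecewiseExpandingMap} (h𝒞 : AdmissibleClass 𝒞)
    (hT : ∀ n, T n ∈ 𝒞) (hmin : ConditionMin T) :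
    ∃ A : ℝ, 0 ≤ A ∧ ∀ (f : unitInterval → ℝ) (L : ℝ≥0), 0 < L → LipschitzWith L f → ∀ k,
      ∃ g : unitInterval → ℝ, Measurable g ∧ (∀ x, |g x| ≤ A * L) ∧ (k = 0 → ∀ x, g x = 0) ∧
        ∀ (G : unitInterval → ℝ) (c : ℝ), Measurable G → (∀ x, |G x| ≤ c) →
          ∫ x, g (orbitMap T k x) * G (orbitMap T k x) =
            ∑ j ∈ Finset.range k, ∫ x, centred T f j (orbitMap T j x) * G (orbitMap T k x) := by
  obtain ⟨r, hr, hD⟩ := h𝒞.condD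
  obtain ⟨θ, K, hθ, -, hDec⟩ := h𝒞.dec
  obtain ⟨B, -, hB⟩ := exists_bvNorm_density_le hr hD hT hmin
  obtain ⟨δ, hδ, hdens⟩ := le_density hmin
  have hθ' : (θ : ℝ) < 1 := by exact_mod_cast hθ
  have hA : 0 ≤ 3 * K * B * (1 - (θ : ℝ))⁻¹ / δ := by
    have : 0 < 1 - (θ : ℝ) := sub_pos.2 hθ'
    positivity
  refine ⟨_, hA, fun f L hL hf k => ?_⟩
  rcases Nat.eq_zero_or_pos k with rfl | hk
  · exact ⟨fun _ => 0, measurable_const, fun x => by simpa using by positivity, fun _ _ => rfl,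
      fun G c _ _ => by simp⟩
  set A : ℝ := 3 * K * B * (1 - (θ : ℝ))⁻¹ / δ with hAdef
  set u : unitInterval → ℝ := fun x => ∑ j ∈ Finset.range k, correlation T f j k x with hu
  have hum : Measurable u := Finset.measurable_sum _ fun j _ => measurable_correlation hf j k
  have hub : ∀ᵐ x, |u x| ≤ A * L * δ := by
    have h : ∀ᵐ x, ∀ j ∈ Finset.range k,
        |correlation T f j k x| ≤ 3 * K * B * L * (θ : ℝ) ^ (k - j) :=
      (Finset.eventually_all _).2 fun j hj =>
        abs_correlation_le hDec hT hB hL hf (Finset.mem_range.1 hj)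
    filter_upwards [h] with x hx
    calc |u x| ≤ ∑ j ∈ Finset.range k, |correlation T f j k x| := Finset.abs_sum_le_sum_abs _ _
      _ ≤ ∑ j ∈ Finset.range k, 3 * K * B * L * (θ : ℝ) ^ (k - j) := Finset.sum_le_sum hx
      _ = 3 * K * B * L * ∑ j ∈ Finset.range k, (θ : ℝ) ^ (k - j) := by rw [Finset.mul_sum]
      _ ≤ 3 * K * B * L * (1 - (θ : ℝ))⁻¹ := by gcongr; exact sum_pow_sub_le θ.2 hθ' k
      _ = _ := by rw [hAdef]; field_simp
  -- Truncation makes the bound hold everywhere and changes the quotient only on a null set.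
  set g : unitInterval → ℝ := fun x => max (-(A * L)) (min (A * L) (u x / density T k x)) with hg
  have hgm : Measurable g :=
    measurable_const.max (measurable_const.min (hum.div (measurable_density k)))
  have hgb : ∀ x, |g x| ≤ A * L := fun x =>
    abs_le.2 ⟨le_max_left _ _, max_le (by linarith [mul_nonneg hA (NNReal.coe_nonneg L)]) (min_le_left _ _)⟩
  have hgu : ∀ᵐ x, density T k x * g x = u x := by
    filter_upwards [hub, hdens k] with x hx hd
    have hd0 : 0 < density T k x := hδ.trans_le hd
    have h1 : |u x / density T k x| ≤ A * L := by
      rw [abs_div, abs_of_pos hd0, div_le_iff₀ hd0]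
      exact hx.trans (by gcongr)
    rw [abs_le] at h1
    rw [hg]
    beta_reduce
    rw [min_eq_right h1.2, max_eq_right h1.1, mul_div_cancel₀ _ hd0.ne']
  refine ⟨g, hgm, hgb, fun h => absurd h hk.ne', fun G c hG hc => ?_⟩
  rw [← integral_density_mul (T := T) k (G := fun x => g x * G x) (hgm.mul hG) (c := A * L * c)
    fun x => by
      rw [abs_mul]
      exact mul_le_mul (hgb x) (hc x) (abs_nonneg _) (by positivity)]
  calc ∫ x, density T k x * (g x * G x)
      = ∫ x, ∑ j ∈ Finset.range k, correlation T f j k x * G x := by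
        refine integral_congr_ae ?_
        filter_upwards [hgu] with x hx
        rw [← mul_assoc, hx, hu, Finset.sum_mul]
    _ = ∑ j ∈ Finset.range k, ∫ x, correlation T f j k x * G x :=
        integral_finsetSum _ fun j _ => integrable_mul_of_abs_le (integrable_correlation hf j k) hG hc
    _ = _ := Finset.sum_congr rfl fun j hj =>
        integral_correlation_mul hf (Finset.mem_range.1 hj).le hG hc

end SeqDyn

/-! ### The reversed martingale differences. -/

namespace SeqDyn

variable {T : ℕ → PiecewiseExpandingMap}

/-- The reversed martingale differences of the centred Birkhoff sum up to time `n`, built from the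
conditional expectations `g k` of the past. -/
noncomputable def revDiff (T : ℕ → PiecewiseExpandingMap) (φ g : ℕ → unitInterval → ℝ) (n k : ℕ)
    (x : unitInterval) : ℝ :=
  if k < n then
    φ k (orbitMap T k x) + g k (orbitMap T k x) - g (k + 1) (orbitMap T (k + 1) x)
  else g k (orbitMap T k x)

variable {φ g : ℕ → unitInterval → ℝ} {a b : ℝ}

theorem measurable_revDiff (hφ : ∀ k, Measurable (φ k)) (hg : ∀ k, Measurable (g k)) (n k : ℕ) :
    Measurable (revDiff T φ g n k) := by
  have hm := fun j => (quasiMeasurePreserving_orbitMap T j).measurable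
  have h1 := (hφ k).comp (hm k)
  have h2 := (hg k).comp (hm k)
  have h3 := (hg (k + 1)).comp (hm (k + 1))
  unfold revDiff
  split_ifs
  · exact (h1.add h2).sub h3
  · exact h2

theorem abs_revDiff_le (hφ : ∀ k x, |φ k x| ≤ a) (hg : ∀ k x, |g k x| ≤ b) (n k : ℕ)
    (x : unitInterval) : |revDiff T φ g n k x| ≤ a + 2 * b := by
  have h1 := abs_le.1 (hφ k (orbitMap T k x))
  have h2 := abs_le.1 (hg k (orbitMap T k x))
  have h3 := abs_le.1 (hg (k + 1) (orbitMap T (k + 1) x))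
  rw [revDiff]
  split_ifs <;> rw [abs_le] <;> constructor <;> linarith

/-- The `g` terms telescope to `g_0 - g_n ∘ T_1^n`, and the extra difference at `k = n` cancels the
remainder; hence `n + 1` differences. -/
theorem sum_revDiff (h0 : ∀ x, g 0 x = 0) (n : ℕ) (x : unitInterval) :
    ∑ k ∈ Finset.range (n + 1), revDiff T φ g n k x =
      ∑ k ∈ Finset.range n, φ k (orbitMap T k x) := by
  have h1 : ∑ k ∈ Finset.range n, revDiff T φ g n k x = ∑ k ∈ Finset.range n,
      (φ k (orbitMap T k x) + (g k (orbitMap T k x) - g (k + 1) (orbitMap T (k + 1) x))) :=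
    Finset.sum_congr rfl fun k hk => by
      rw [revDiff, if_pos (Finset.mem_range.1 hk), add_sub_assoc]
  rw [Finset.sum_range_succ, h1, Finset.sum_add_distrib,
    Finset.sum_range_sub' fun k => g k (orbitMap T k x), h0, revDiff, if_neg (lt_irrefl n)]
  ring

/-- Shifting time shows that differences from time `j` on are functions of `T_1^j`, which replaces
measurability with respect to a decreasing filtration. -/
theorem revDiff_eq_comp {j k : ℕ} (hjk : j ≤ k) (n : ℕ) (x : unitInterval) :
    revDiff T φ g n k x =
      revDiff (fun i => T (j + i)) (fun i => φ (j + i)) (fun i => g (j + i)) (n - j) (k - j)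
        (orbitMap T j x) := by
  have h : k < n ↔ k - j < n - j := by omega
  simp only [revDiff, ← orbitMap_add, ← add_assoc, Nat.add_sub_cancel' hjk, h]

/-- The exponential is `H ∘ T_1^{k+1}`. Against it, `g_{k+1}` yields the correlations of all `φ_j`
with `j ≤ k`, while `g_k` yields those with `j < k`; the term `φ_k` makes up the difference. -/
theorem integral_revDiff_mul_exp (hφ : ∀ k, Measurable (φ k)) (hg : ∀ k, Measurable (g k))
    (hφb : ∀ k x, |φ k x| ≤ a) (hgb : ∀ k x, |g k x| ≤ b)
    (hφ0 : ∀ k, ∫ x, φ k (orbitMap T k x) = 0)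
    (hgφ : ∀ k (G : unitInterval → ℝ) (c : ℝ), Measurable G → (∀ x, |G x| ≤ c) →
      ∫ x, g k (orbitMap T k x) * G (orbitMap T k x) =
        ∑ j ∈ Finset.range k, ∫ x, φ j (orbitMap T j x) * G (orbitMap T k x))
    (s : ℝ) {n k : ℕ} (hk : k < n + 1) :
    ∫ x, revDiff T φ g n k x *
      Real.exp (s * ∑ i ∈ Finset.Ico (k + 1) (n + 1), revDiff T φ g n i x) = 0 := by
  rcases Nat.lt_succ_iff_lt_or_eq.1 hk with hkn | rfl
  · set H : unitInterval → ℝ := fun y => Real.exp (s * ∑ i ∈ Finset.Ico (k + 1) (n + 1),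
      revDiff (fun i => T (k + 1 + i)) (fun i => φ (k + 1 + i)) (fun i => g (k + 1 + i))
        (n - (k + 1)) (i - (k + 1)) y) with hH
    have hHm : Measurable H := by
      have := fun i => measurable_revDiff (T := fun i => T (k + 1 + i))
        (φ := fun i => φ (k + 1 + i)) (g := fun i => g (k + 1 + i))
        (fun i => hφ _) (fun i => hg _) (n - (k + 1)) (i - (k + 1))
      fun_prop
    obtain ⟨c, hHb⟩ : ∃ c, ∀ x, |H x| ≤ c := by
      refine ⟨Real.exp (|s| * ((Finset.Ico (k + 1) (n + 1)).card * (a + 2 * b))), fun x => ?_⟩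
      rw [hH, Real.abs_exp]
      exact exp_mul_sum_le (fun i => abs_revDiff_le (T := fun i => T (k + 1 + i)) (fun j => hφb _) (fun j => hgb _) _ _ _) s _
    have hHe : ∀ x, Real.exp (s * ∑ i ∈ Finset.Ico (k + 1) (n + 1), revDiff T φ g n i x) =
        H (orbitMap T (k + 1) x) := by
      intro x
      rw [hH]
      congr 2
      exact Finset.sum_congr rfl fun i hi => revDiff_eq_comp (Finset.mem_Ico.1 hi).1 n x
    simp only [hHe]
    simp only [revDiff, hkn, if_true]
    have hHm' : Measurable fun x => H (orbitMap T (k + 1) x) :=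
      hHm.comp (quasiMeasurePreserving_orbitMap T (k + 1)).measurable
    have i1 : Integrable fun x => φ k (orbitMap T k x) * H (orbitMap T (k + 1) x) :=
      integrable_mul_of_abs_le (integrable_comp_orbitMap (hφ k) (hφb k) k) hHm' fun x => hHb _
    have i2 : Integrable fun x => g k (orbitMap T k x) * H (orbitMap T (k + 1) x) :=
      integrable_mul_of_abs_le (integrable_comp_orbitMap (hg k) (hgb k) k) hHm' fun x => hHb _
    have i3 : Integrable fun x => g (k + 1) (orbitMap T (k + 1) x) * H (orbitMap T (k + 1) x) :=
      integrable_mul_of_abs_le (integrable_comp_orbitMap (hg _) (hgb _) _) hHm' fun x => hHb _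
    -- `H ∘ T_1^{k+1}` is also a function of `T_1^k`, with test function `H ∘ T_{k+1}`.
    have e2 := hgφ k (fun y => H ((T k).toFun y)) c (hHm.comp (T k).measurable_toFun)
      fun x => hHb _
    have e3 := hgφ (k + 1) H c hHm hHb
    rw [Finset.sum_range_succ] at e3
    have i12 : Integrable fun x => φ k (orbitMap T k x) * H (orbitMap T (k + 1) x) +
      g k (orbitMap T k x) * H (orbitMap T (k + 1) x) := i1.add i2
    simp only [sub_mul, add_mul]
    rw [integral_sub i12 i3, integral_add i1 i2, e3]
    have e2' : ∫ x, g k (orbitMap T k x) * H (orbitMap T (k + 1) x) =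
        ∑ j ∈ Finset.range k, ∫ x, φ j (orbitMap T j x) * H (orbitMap T (k + 1) x) := e2
    rw [e2']
    ring
  -- Last index: the sum in the exponent is empty, and `g_n ∘ T_1^n` has mean zero by testing
  -- against `1`.
  · have h := hgφ k (fun _ => 1) 1 measurable_const (by simp)
    simp only [mul_one, hφ0, Finset.sum_const_zero] at h
    simpa [revDiff] using h

end SeqDyn

/-- The constant `L` ranges over all positive Lipschitz constants of `f`. For non-constant `f` one
may take the least one, `Lip(f)`; for constant `f` letting `L → 0` gives probability zero. -/
theorem mainTheorem3 (𝒞 : Set SeqDyn.PiecewiseExpandingMap) (h𝒞 : SeqDyn.AdmissibleClass 𝒞)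
    (T : ℕ → SeqDyn.PiecewiseExpandingMap) (hT : ∀ n, T n ∈ 𝒞) (hmin : SeqDyn.ConditionMin T) :
    ∃ C : ℝ, 0 < C ∧
      ∀ (f : unitInterval → ℝ) (L : ℝ≥0), 0 < L → LipschitzWith L f →
        ∀ n : ℕ, 1 ≤ n → ∀ t : ℝ, 0 < t →
          volume {x : unitInterval | t < (1 / (n : ℝ)) * ∑ k ∈ Finset.range n,
              (f (SeqDyn.orbitMap T k x) - ∫ y : unitInterval, f (SeqDyn.orbitMap T k y))}
            ≤ ENNReal.ofReal (Real.exp (-(C * n * t ^ 2 / (L : ℝ) ^ 2))) := by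
  obtain ⟨A, hA, hpast⟩ := SeqDyn.exists_condExp_pastSum h𝒞 hT hmin
  -- Azuma's exponent with `n + 1 ≤ 2 n` differences, each bounded by `(1 + 2A) L`.
  refine ⟨1 / (4 * (1 + 2 * A) ^ 2), by positivity, fun f L hL hf n hn t ht => ?_⟩
  choose g hgm hgb hg0 hgφ using hpast f L hL hf
  have hL' : (0 : ℝ) < L := hL
  have hn' : (1 : ℝ) ≤ n := by exact_mod_cast hn
  have hφm := SeqDyn.measurable_centred (T := T) hf
  have hφb := SeqDyn.abs_centred_le (T := T) hf
  have key := SeqDyn.measure_lt_sum_le (μ := volume) (N := n + 1) (c := L + 2 * (A * L))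
    (X := SeqDyn.revDiff T (SeqDyn.centred T f) g n)
    (SeqDyn.measurable_revDiff hφm hgm n) (by positivity) (SeqDyn.abs_revDiff_le hφb hgb n)
    (by omega)
    (fun s k hk => SeqDyn.integral_revDiff_mul_exp hφm hgm hφb hgb
      (SeqDyn.integral_centred_comp_orbitMap hf) hgφ s hk)
    (a := n * t) (by positivity)
  simp only [SeqDyn.sum_revDiff (hg0 0 rfl)] at key
  refine (measure_mono fun x hx => ?_).trans (key.trans (ENNReal.ofReal_le_ofReal
    (Real.exp_le_exp.2 (neg_le_neg ?_))))
  · rw [mem_ofPred_eq, one_div, inv_mul_eq_div, lt_div_iff₀ (by positivity)] at hx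
    rw [mem_ofPred_eq, mul_comm]
    exact hx
  · calc 1 / (4 * (1 + 2 * A) ^ 2) * n * t ^ 2 / (L : ℝ) ^ 2
        = (n * t) ^ 2 / (2 * (2 * n) * (L + 2 * (A * L)) ^ 2) := by
          have : (L : ℝ) + 2 * (A * L) = (1 + 2 * A) * L := by ring
          rw [this]
          field_simp
          ring
      _ ≤ (n * t) ^ 2 / (2 * (n + 1 : ℕ) * (L + 2 * (A * L)) ^ 2) := by
          have : ((n + 1 : ℕ) : ℝ) ≤ 2 * n := by push_cast; linarith
          gcongr
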